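/- Let $\alpha>0$ and $L>0$ be real numbers and, for $\lambda\in\mathbb{C}$, let $$f(\lambda) = (\alpha^2+\lambda^2)\sin(L\lambda) + 2i\alpha\lambda\cos(L\lambda).$$ There are a real number $Y_0>\alpha$ and a positive integer $n_0$ (depending on $\alpha$ and $L$) such that for every integer $n>n_0$ and every real $Y>Y_0$ the function $f$ has exactly $2n+3$ zeros, counted with multiplicity, in the open rectangle $$\{z\in\mathbb{C} : |\operatorname{Re} z|<(n+\tfrac12)\pi/L,\ |\operatorname{Im} z|<Y\}.$$ -/

import Mathlib

/-- The entire function `f(z) = (α² + z²) sin (L z) + 2 i α z cos (L z)` from the eigenvalue relation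
`f(λ) = 0`. -/
noncomputable def eigenvalueFun (α L : ℝ) (z : ℂ) : ℂ :=
  ((α : ℂ) ^ 2 + z ^ 2) * Complex.sin (L * z) + 2 * Complex.I * α * z * Complex.cos (L * z)

/-- The open rectangle `{x + i y : |x| < (n + 1/2) π / L, |y| < Y}`. -/
def openRect (L : ℝ) (n : ℕ) (Y : ℝ) : Set ℂ :=
  {z : ℂ | |z.re| < ((n : ℝ) + 1 / 2) * Real.pi / L ∧ |z.im| < Y}

/-- The set of zeros of `g` in `S`. -/
def zerosIn (g : ℂ → ℂ) (S : Set ℂ) : Set ℂ := {z : ℂ | z ∈ S ∧ g z = 0}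

/-- `g` has exactly `N` zeros in `S`, counted with multiplicity: the zero set is finite, and the
orders of vanishing of `g` (in `ℕ∞`, so that an infinite order is not discarded) sum to `N`. -/
def HasExactlyZeros (g : ℂ → ℂ) (S : Set ℂ) (N : ℕ) : Prop :=
  (zerosIn g S).Finite ∧ ∑ᶠ z ∈ zerosIn g S, analyticOrderAt g z = (N : ℕ∞)

/-! Rouché's theorem compares `f` with `z ^ 2 * sin (L z)`. The difference is `α² sin (L z) + 2iαz
cos (L z)`. On the boundary of the rectangle `|cos (L z)| ≤ 2 |sin (L z)|`
(`norm_cos_le_two_mul_norm_sin`), so once `|z| ≥ 5α` the quadratic term dominates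
(`norm_eigenvalueFun_sub_lt`). The comparison function vanishes at `kπ/L`, `|k| ≤ n`: simply for `k
≠ 0`, to order 3 at the origin, which gives `2n + 3`. Rouché's theorem
(`HasExactlyZeros.of_norm_sub_lt`) comes from the argument principle
`rectBoundaryIntegral_logDeriv`, which rests on dividing out the zeros and on the integral of `1 /
(z - w)`. -/

open Set Topology Filter

/-- The integral of `F` along the positively oriented boundary of the rectangle
`[-A, A] × [-Y, Y]`. -/
noncomputable def rectBoundaryIntegral (A Y : ℝ) (F : ℂ → ℂ) : ℂ :=
  (∫ x : ℝ in -A..A, F (x + (-Y : ℝ) * Complex.I)) - (∫ x : ℝ in -A..A, F (x + Y * Complex.I)) +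
    Complex.I * (∫ y : ℝ in -Y..Y, F (A + y * Complex.I)) -
    Complex.I * (∫ y : ℝ in -Y..Y, F ((-A : ℝ) + y * Complex.I))

/-- The open rectangle `(-A, A) × (-Y, Y)`. -/
def symmRect (A Y : ℝ) : Set ℂ := {z | |z.re| < A ∧ |z.im| < Y}

/-- The closed rectangle `[-A, A] × [-Y, Y]`. -/
def closedSymmRect (A Y : ℝ) : Set ℂ := {z | |z.re| ≤ A ∧ |z.im| ≤ Y}

/-- The boundary of the rectangle `[-A, A] × [-Y, Y]`. -/
def rectBoundary (A Y : ℝ) : Set ℂ :=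
  {z | (|z.re| ≤ A ∧ |z.im| = Y) ∨ (|z.re| = A ∧ |z.im| ≤ Y)}

/-! ### Integrals along the boundary of a rectangle. -/

section boundary

variable {A Y : ℝ} {F G : ℂ → ℂ}

lemma mem_closedSymmRect_iff {z : ℂ} :
    z ∈ closedSymmRect A Y ↔ z ∈ symmRect A Y ∨ z ∈ rectBoundary A Y := by
  simp only [closedSymmRect, symmRect, rectBoundary, mem_ofPred_eq]
  constructor
  · rintro ⟨h1, h2⟩
    rcases h1.lt_or_eq with h1' | h1' <;> rcases h2.lt_or_eq with h2' | h2' <;> tauto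
  · rintro (h | h | h)
    · exact ⟨h.1.le, h.2.le⟩
    · exact ⟨h.1, h.2.le⟩
    · exact ⟨h.1.le, h.2⟩

lemma horizontal_mem_rectBoundary (hA : 0 < A) {x c : ℝ} (hc : |c| = Y) (hx : x ∈ uIcc (-A) A) :
    (x : ℂ) + c * Complex.I ∈ rectBoundary A Y := by
  rw [uIcc_of_le (by linarith)] at hx
  left
  simpa [hc, abs_le] using hx

lemma vertical_mem_rectBoundary (hY : 0 < Y) {y c : ℝ} (hc : |c| = A) (hy : y ∈ uIcc (-Y) Y) :
    (c : ℂ) + y * Complex.I ∈ rectBoundary A Y := by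
  rw [uIcc_of_le (by linarith)] at hy
  right
  simpa [hc, abs_le] using hy

lemma ContinuousOn.comp_horizontal (hA : 0 < A) {c : ℝ} (hc : |c| = Y)
    (hF : ContinuousOn F (rectBoundary A Y)) :
    ContinuousOn (fun x : ℝ => F (x + c * Complex.I)) (uIcc (-A) A) :=
  hF.comp (by fun_prop) fun _ hx => horizontal_mem_rectBoundary hA hc hx

lemma ContinuousOn.comp_vertical (hY : 0 < Y) {c : ℝ} (hc : |c| = A)
    (hF : ContinuousOn F (rectBoundary A Y)) :
    ContinuousOn (fun y : ℝ => F (c + y * Complex.I)) (uIcc (-Y) Y) :=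
  hF.comp (by fun_prop) fun _ hy => vertical_mem_rectBoundary hY hc hy

lemma rectBoundaryIntegral_congr (hA : 0 < A) (hY : 0 < Y) (h : EqOn F G (rectBoundary A Y)) :
    rectBoundaryIntegral A Y F = rectBoundaryIntegral A Y G := by
  unfold rectBoundaryIntegral
  congr 1
  · congr 1
    · congr 1
      · exact intervalIntegral.integral_congr fun x hx =>
          h (horizontal_mem_rectBoundary hA (by simp [abs_of_pos hY]) hx)
      · exact intervalIntegral.integral_congr fun x hx =>
          h (horizontal_mem_rectBoundary hA (abs_of_pos hY) hx)
    · congr 1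
      exact intervalIntegral.integral_congr fun x hx =>
          h (vertical_mem_rectBoundary hY (abs_of_pos hA) hx)
  · congr 1
    exact intervalIntegral.integral_congr fun x hx =>
          h (vertical_mem_rectBoundary hY (by simp [abs_of_pos hA]) hx)

lemma rectBoundaryIntegral_add (hA : 0 < A) (hY : 0 < Y) (hF : ContinuousOn F (rectBoundary A Y))
    (hG : ContinuousOn G (rectBoundary A Y)) :
    rectBoundaryIntegral A Y (fun z => F z + G z) =
      rectBoundaryIntegral A Y F + rectBoundaryIntegral A Y G := by
  have a1 : |(-Y : ℝ)| = Y := by simp [abs_of_pos hY]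
  have a2 : |(-A : ℝ)| = A := by simp [abs_of_pos hA]
  unfold rectBoundaryIntegral
  rw [intervalIntegral.integral_add (hF.comp_horizontal hA a1).intervalIntegrable
      (hG.comp_horizontal hA a1).intervalIntegrable,
    intervalIntegral.integral_add (hF.comp_horizontal hA (abs_of_pos hY)).intervalIntegrable
      (hG.comp_horizontal hA (abs_of_pos hY)).intervalIntegrable,
    intervalIntegral.integral_add (hF.comp_vertical hY (abs_of_pos hA)).intervalIntegrable
      (hG.comp_vertical hY (abs_of_pos hA)).intervalIntegrable,
    intervalIntegral.integral_add (hF.comp_vertical hY a2).intervalIntegrable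
      (hG.comp_vertical hY a2).intervalIntegrable]
  ring

lemma rectBoundaryIntegral_const_mul (c : ℂ) :
    rectBoundaryIntegral A Y (fun z => c * F z) = c * rectBoundaryIntegral A Y F := by
  simp only [rectBoundaryIntegral, intervalIntegral.integral_const_mul]
  ring

lemma rectBoundaryIntegral_sum (hA : 0 < A) (hY : 0 < Y) {ι : Type*} (s : Finset ι)
    (f : ι → ℂ → ℂ) (hf : ∀ i ∈ s, ContinuousOn (f i) (rectBoundary A Y)) :
    rectBoundaryIntegral A Y (fun z => ∑ i ∈ s, f i z) =
      ∑ i ∈ s, rectBoundaryIntegral A Y (f i) := by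
  classical
  induction s using Finset.induction_on with
  | empty => simp [rectBoundaryIntegral]
  | insert a s ha ih =>
    simp only [Finset.sum_insert ha]
    rw [rectBoundaryIntegral_add hA hY (hf a (by simp))
      (continuousOn_finsetSum _ fun i hi => hf i (by simp [hi])),
      ih fun i hi => hf i (by simp [hi])]

lemma integral_horizontal_of_hasDerivAt {a b c : ℝ}
    (h : ∀ x ∈ uIcc a b, HasDerivAt G (F ((x : ℝ) + c * Complex.I)) ((x : ℝ) + c * Complex.I))
    (hF : ContinuousOn (fun x : ℝ => F (x + c * Complex.I)) (uIcc a b)) :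
    ∫ x : ℝ in a..b, F (x + c * Complex.I) = G (b + c * Complex.I) - G (a + c * Complex.I) := by
  refine intervalIntegral.integral_eq_sub_of_hasDerivAt
    (f := fun x : ℝ => G (x + c * Complex.I)) (fun x hx => ?_) hF.intervalIntegrable
  have h1 : HasDerivAt (fun x : ℂ => x + c * Complex.I) 1 (x : ℂ) := (hasDerivAt_id _).add_const _
  simpa using ((h x hx).comp (x : ℂ) h1).comp_ofReal

lemma integral_vertical_of_hasDerivAt {a b c : ℝ}
    (h : ∀ y ∈ uIcc a b, HasDerivAt G (F (c + (y : ℝ) * Complex.I)) (c + (y : ℝ) * Complex.I))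
    (hF : ContinuousOn (fun y : ℝ => F (c + y * Complex.I)) (uIcc a b)) :
    Complex.I * ∫ y : ℝ in a..b, F (c + y * Complex.I) =
      G (c + b * Complex.I) - G (c + a * Complex.I) := by
  rw [← intervalIntegral.integral_const_mul]
  refine intervalIntegral.integral_eq_sub_of_hasDerivAt
    (f := fun y : ℝ => G (c + y * Complex.I)) (fun y hy => ?_)
    (continuousOn_const.mul hF).intervalIntegrable
  have h1 : HasDerivAt (fun y : ℂ => c + y * Complex.I) Complex.I (y : ℂ) := by
    simpa using ((hasDerivAt_id (y : ℂ)).mul_const Complex.I).const_add (c : ℂ)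
  simpa [mul_comm] using ((h y hy).comp (y : ℂ) h1).comp_ofReal

lemma rectBoundaryIntegral_eq_zero_of_hasDerivAt (hA : 0 < A) (hY : 0 < Y)
    (hF : ContinuousOn F (rectBoundary A Y)) (h : ∀ z ∈ rectBoundary A Y, HasDerivAt G (F z) z) :
    rectBoundaryIntegral A Y F = 0 := by
  have a1 : |(-Y : ℝ)| = Y := by simp [abs_of_pos hY]
  have a2 : |(-A : ℝ)| = A := by simp [abs_of_pos hA]
  unfold rectBoundaryIntegral
  rw [integral_horizontal_of_hasDerivAt
      (fun x hx => h _ (horizontal_mem_rectBoundary hA a1 hx)) (hF.comp_horizontal hA a1),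
    integral_horizontal_of_hasDerivAt
      (fun x hx => h _ (horizontal_mem_rectBoundary hA (abs_of_pos hY) hx))
      (hF.comp_horizontal hA (abs_of_pos hY)),
    integral_vertical_of_hasDerivAt
      (fun x hx => h _ (vertical_mem_rectBoundary hY (abs_of_pos hA) hx))
      (hF.comp_vertical hY (abs_of_pos hA)),
    integral_vertical_of_hasDerivAt
      (fun x hx => h _ (vertical_mem_rectBoundary hY a2 hx)) (hF.comp_vertical hY a2)]
  ring

lemma rectBoundaryIntegral_eq_zero_of_differentiableOn (hA : 0 < A) (hY : 0 < Y)
    (hF : DifferentiableOn ℂ F (closedSymmRect A Y)) : rectBoundaryIntegral A Y F = 0 := by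
  have h := Complex.integral_boundary_rect_eq_zero_of_differentiableOn F
    ⟨-A, -Y⟩ ⟨A, Y⟩ (hF.mono fun z hz => by
      rw [Complex.mem_reProdIm, uIcc_of_le (by simp; linarith), uIcc_of_le (by simp; linarith)] at hz
      exact ⟨abs_le.2 hz.1, abs_le.2 hz.2⟩)
  simpa [rectBoundaryIntegral] using h

lemma Complex.log_neg_of_im_pos {z : ℂ} (hz : 0 < z.im) :
    Complex.log (-z) = Complex.log z - Real.pi * Complex.I := by
  simp only [Complex.log, norm_neg, Complex.arg_neg_eq_arg_sub_pi_of_im_pos hz]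
  push_cast; ring

lemma Complex.log_neg_of_im_neg {z : ℂ} (hz : z.im < 0) :
    Complex.log (-z) = Complex.log z + Real.pi * Complex.I := by
  simp only [Complex.log, norm_neg, Complex.arg_neg_eq_arg_add_pi_of_im_neg hz]
  push_cast; ring

lemma sub_ne_zero_of_mem_rectBoundary {w z : ℂ} (hw : w ∈ symmRect A Y)
    (hz : z ∈ rectBoundary A Y) : z - w ≠ 0 := by
  intro h
  rw [sub_eq_zero] at h
  subst h
  rcases hz with hz | hz
  · exact hw.2.ne hz.2
  · exact hw.1.ne hz.1

lemma continuousOn_inv_sub_rectBoundary {w : ℂ} (hw : w ∈ symmRect A Y) :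
    ContinuousOn (fun z => (z - w)⁻¹) (rectBoundary A Y) :=
  ContinuousOn.inv₀ (by fun_prop) fun _ hz => sub_ne_zero_of_mem_rectBoundary hw hz

/-- The principal branch of `log (z - w)` is a primitive on the bottom, right and top sides. The
left side crosses its cut, so `log (w - z)` serves there. The primitives match at the right corners
and differ by `±πi` at the left ones; these two jumps make up `2πi`. -/
lemma rectBoundaryIntegral_inv_sub {w : ℂ} (hw : w ∈ symmRect A Y) :
    rectBoundaryIntegral A Y (fun z => (z - w)⁻¹) = 2 * Real.pi * Complex.I := by
  have hA : 0 < A := (abs_nonneg _).trans_lt hw.1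
  have hY : 0 < Y := (abs_nonneg _).trans_lt hw.2
  have a1 : |(-Y : ℝ)| = Y := by simp [abs_of_pos hY]
  have a2 : |(-A : ℝ)| = A := by simp [abs_of_pos hA]
  obtain ⟨hr1, hr2⟩ := abs_lt.1 hw.1
  obtain ⟨hi1, hi2⟩ := abs_lt.1 hw.2
  have hF := continuousOn_inv_sub_rectBoundary hw
  have key : ∀ z : ℂ, z - w ∈ Complex.slitPlane →
      HasDerivAt (fun z => Complex.log (z - w)) (z - w)⁻¹ z := fun z hz => by
    simpa using ((hasDerivAt_id z).sub_const w).clog hz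
  have key' : ∀ z : ℂ, w - z ∈ Complex.slitPlane →
      HasDerivAt (fun z => Complex.log (w - z)) (z - w)⁻¹ z := fun z hz => by
    have := ((hasDerivAt_id z).const_sub w).clog hz
    have e : (z - w)⁻¹ = -1 / (w - id z) := by
      rw [id, ← neg_sub w z, inv_neg, neg_div, one_div]
    rwa [e]
  unfold rectBoundaryIntegral
  rw [integral_horizontal_of_hasDerivAt (F := fun z => (z - w)⁻¹)
      (fun x _ => key _ (by right; simp; linarith)) (hF.comp_horizontal hA a1),
    integral_horizontal_of_hasDerivAt (F := fun z => (z - w)⁻¹)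
      (fun x _ => key _ (by right; simp; linarith)) (hF.comp_horizontal hA (abs_of_pos hY)),
    integral_vertical_of_hasDerivAt (F := fun z => (z - w)⁻¹)
      (fun x _ => key _ (by left; simp; linarith)) (hF.comp_vertical hY (abs_of_pos hA)),
    integral_vertical_of_hasDerivAt (F := fun z => (z - w)⁻¹)
      (fun x _ => key' _ (by left; simp; linarith)) (hF.comp_vertical hY a2)]
  have e1 := Complex.log_neg_of_im_pos (z := ((-A : ℝ) : ℂ) + Y * Complex.I - w)
    (by simp; linarith)
  have e2 := Complex.log_neg_of_im_neg (z := ((-A : ℝ) : ℂ) + (-Y : ℝ) * Complex.I - w)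
    (by simp; linarith)
  rw [neg_sub] at e1 e2
  rw [e1, e2]
  ring

end boundary

/-! ### Orders of zeros, the argument principle and Rouché's theorem. -/

section zeros

variable {f g : ℂ → ℂ}

/-- An entire function that does not vanish identically can be divided by its zero at `w`. -/
lemma Differentiable.exists_eq_pow_mul {f : ℂ → ℂ} (hf : Differentiable ℂ f) {w : ℂ}
    (hw : analyticOrderAt f w ≠ ⊤) :
    ∃ g : ℂ → ℂ, Differentiable ℂ g ∧ g w ≠ 0 ∧
      ∀ z, f z = (z - w) ^ (analyticOrderAt f w).toNat * g z := by
  obtain ⟨h, hh, hhw, hfh⟩ := (hf.analyticAt w).analyticOrderAt_ne_top.1 hw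
  set n := analyticOrderNatAt f w with hn
  have hn' : (analyticOrderAt f w).toNat = n := rfl
  -- At `w` the quotient takes the value of the local analytic cofactor `h`, which removes the
  -- singularity.
  refine ⟨Function.update (fun z => f z / (z - w) ^ n) w (h w), fun z => ?_, by simpa using hhw,
    fun z => ?_⟩
  · rcases eq_or_ne z w with rfl | hz
    · refine hh.differentiableAt.congr_of_eventuallyEq ?_
      filter_upwards [hfh] with x hx
      rcases eq_or_ne x z with rfl | hxz
      · simp
      · have : (x - z) ^ n ≠ 0 := pow_ne_zero _ (sub_ne_zero.2 hxz)
        rw [Function.update_of_ne hxz, hx, smul_eq_mul]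
        field_simp
    · have hd : DifferentiableAt ℂ (fun z => f z / (z - w) ^ n) z :=
        (hf z).fun_div (by fun_prop) (pow_ne_zero _ (sub_ne_zero.2 hz))
      refine hd.congr_of_eventuallyEq ?_
      filter_upwards [isOpen_ne.mem_nhds hz] with x hx
      rw [Function.update_of_ne hx]
  · rw [hn']
    rcases eq_or_ne z w with rfl | hz
    · simpa using hfh.self_of_nhds
    · have : (z - w) ^ n ≠ 0 := pow_ne_zero _ (sub_ne_zero.2 hz)
      rw [Function.update_of_ne hz]
      field_simp

lemma Differentiable.exists_eq_prod_mul {f : ℂ → ℂ} (hf : Differentiable ℂ f)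
    (hne : ∀ w, analyticOrderAt f w ≠ ⊤) (s : Finset ℂ) :
    ∃ g : ℂ → ℂ, Differentiable ℂ g ∧ (∀ w ∈ s, g w ≠ 0) ∧
      ∀ z, f z = (∏ w ∈ s, (z - w) ^ (analyticOrderAt f w).toNat) * g z := by
  induction s using Finset.induction_on with
  | empty => exact ⟨f, hf, by simp, by simp⟩
  | insert a s ha ih =>
    obtain ⟨g, hg, hgs, hfg⟩ := ih
    have hP : Differentiable ℂ fun z => ∏ w ∈ s, (z - w) ^ (analyticOrderAt f w).toNat := by
      fun_prop
    have hPa : ∏ w ∈ s, (a - w) ^ (analyticOrderAt f w).toNat ≠ 0 :=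
      Finset.prod_ne_zero_iff.2 fun w hw => pow_ne_zero _ (sub_ne_zero.2 fun h => ha (h ▸ hw))
    -- The factors already removed do not vanish at `a`, so the cofactor `g` still has the full
    -- order of `f` there.
    have hord : analyticOrderAt f a = analyticOrderAt g a := by
      have e : f = (fun z => ∏ w ∈ s, (z - w) ^ (analyticOrderAt f w).toNat) * g := funext hfg
      conv_lhs => rw [e]
      rw [analyticOrderAt_mul (hP.analyticAt a) (hg.analyticAt a),
        (hP.analyticAt a).analyticOrderAt_eq_zero.2 hPa, zero_add]
    obtain ⟨k, hk, hka, hgk⟩ := hg.exists_eq_pow_mul (hord ▸ hne a)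
    refine ⟨k, hk, fun w hw => ?_, fun z => ?_⟩
    · rcases Finset.mem_insert.1 hw with rfl | hw
      · exact hka
      · intro h0
        exact hgs w hw (by rw [hgk w, h0, mul_zero])
    · rw [Finset.prod_insert ha, hfg z, hgk z, hord]
      ring

lemma isCompact_closedSymmRect (A Y : ℝ) : IsCompact (closedSymmRect A Y) := by
  have : closedSymmRect A Y = Icc (-A) A ×ℂ Icc (-Y) Y := by
    ext z
    simp only [closedSymmRect, mem_ofPred_eq, Complex.mem_reProdIm, mem_Icc, abs_le]
  rw [this]
  exact isCompact_Icc.reProdIm isCompact_Icc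

lemma Differentiable.finite_zeros_inter_of_isCompact (hf : Differentiable ℂ f) {x : ℂ}
    (hx : f x ≠ 0) {K : Set ℂ} (hK : IsCompact K) : {z | z ∈ K ∧ f z = 0}.Finite := by
  have hfn : AnalyticOnNhd ℂ f univ := fun z _ => hf.analyticAt z
  by_contra hinf
  obtain ⟨z, hz, hacc⟩ := Set.Infinite.exists_accPt_of_subset_isCompact hinf hK fun z hz => hz.1
  have h1 : ∃ᶠ y in 𝓝[≠] z, f y = 0 :=
    (accPt_iff_frequently_nhdsNE.1 hacc).mono fun y hy => hy.2
  exact hx (hfn.eqOn_zero_of_preconnected_of_frequently_eq_zero isPreconnected_univ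
    (mem_univ z) h1 (mem_univ x))

lemma Differentiable.analyticOrderAt_ne_top (hf : Differentiable ℂ f) {x : ℂ} (hx : f x ≠ 0)
    (w : ℂ) : analyticOrderAt f w ≠ ⊤ := by
  intro h
  refine hx ((AnalyticOnNhd.eqOn_zero_of_preconnected_of_eventuallyEq_zero
    (fun z _ => hf.analyticAt z) isPreconnected_univ (mem_univ w)
    (analyticOrderAt_eq_top.1 h)) (mem_univ x))

variable {A Y : ℝ}

lemma corner_mem_rectBoundary (hA : 0 < A) (hY : 0 < Y) : (⟨A, Y⟩ : ℂ) ∈ rectBoundary A Y :=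
  Or.inl ⟨(abs_of_pos hA).le, abs_of_pos hY⟩

lemma finite_zerosIn_symmRect (hA : 0 < A) (hY : 0 < Y) (hf : Differentiable ℂ f)
    (hb : ∀ z ∈ rectBoundary A Y, f z ≠ 0) : (zerosIn f (symmRect A Y)).Finite :=
  (hf.finite_zeros_inter_of_isCompact (hb _ (corner_mem_rectBoundary hA hY))
    (isCompact_closedSymmRect A Y)).subset fun _ hz => ⟨mem_closedSymmRect_iff.2 (Or.inl hz.1), hz.2⟩

/-- The argument principle on a rectangle. -/
lemma rectBoundaryIntegral_logDeriv (hA : 0 < A) (hY : 0 < Y) (hf : Differentiable ℂ f)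
    (hb : ∀ z ∈ rectBoundary A Y, f z ≠ 0) :
    rectBoundaryIntegral A Y (logDeriv f) = 2 * Real.pi * Complex.I *
      ((∑ w ∈ (finite_zerosIn_symmRect hA hY hf hb).toFinset, (analyticOrderAt f w).toNat : ℕ) :
        ℂ) := by
  set s := (finite_zerosIn_symmRect hA hY hf hb).toFinset with hs
  have hsr : ∀ w ∈ s, w ∈ symmRect A Y := fun w hw => by
    rw [hs, Set.Finite.mem_toFinset] at hw
    exact hw.1
  -- With all zeros divided out, `g` has none in the closed rectangle. Hence `logDeriv g` integrates
  -- to zero by Cauchy, and only the terms `order / (z - w)` remain.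
  obtain ⟨g, hg, hgs, hfg⟩ := hf.exists_eq_prod_mul
    (hf.analyticOrderAt_ne_top (hb _ (corner_mem_rectBoundary hA hY))) s
  have hg0 : ∀ z ∈ closedSymmRect A Y, g z ≠ 0 := fun z hz h0 => by
    have hfz : f z = 0 := by rw [hfg z, h0, mul_zero]
    rcases mem_closedSymmRect_iff.1 hz with hz | hz
    · exact hgs z (by rw [hs, Set.Finite.mem_toFinset]; exact ⟨hz, hfz⟩) h0
    · exact hb z hz hfz
  have hgb : ∀ z ∈ rectBoundary A Y, g z ≠ 0 := fun z hz =>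
    hg0 z (mem_closedSymmRect_iff.2 (Or.inr hz))
  have hgd : DifferentiableOn ℂ (logDeriv g) (closedSymmRect A Y) := fun z hz =>
    ((hg.analyticAt z).deriv.differentiableAt.div (hg z) (hg0 z hz)).differentiableWithinAt
  have hcont : ∀ w ∈ s, ContinuousOn
      (fun z => ((analyticOrderAt f w).toNat : ℂ) * (z - w)⁻¹) (rectBoundary A Y) := fun w hw =>
    continuousOn_const.mul (continuousOn_inv_sub_rectBoundary (hsr w hw))
  have hEq : EqOn (logDeriv f) (fun z => (∑ w ∈ s, ((analyticOrderAt f w).toNat : ℂ) * (z - w)⁻¹) +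
      logDeriv g z) (rectBoundary A Y) := fun z hz => by
    have hne : ∀ w ∈ s, (z - w) ^ (analyticOrderAt f w).toNat ≠ 0 := fun w hw =>
      pow_ne_zero _ (sub_ne_zero_of_mem_rectBoundary (hsr w hw) hz)
    have e : logDeriv f z =
        logDeriv (fun z => (∏ w ∈ s, (z - w) ^ (analyticOrderAt f w).toNat) * g z) z := by
      rw [← funext hfg]
    rw [e, logDeriv_mul z (Finset.prod_ne_zero_iff.2 hne) (hgb z hz) (by fun_prop) (hg z),
      logDeriv_prod hne (fun w _ => by fun_prop)]
    congr 1
    refine Finset.sum_congr rfl fun w _ => ?_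
    rw [logDeriv_fun_pow (by fun_prop), logDeriv_apply]
    simp
  rw [rectBoundaryIntegral_congr hA hY hEq, rectBoundaryIntegral_add hA hY
    (continuousOn_finsetSum _ hcont)
    (hgd.continuousOn.mono fun z hz => mem_closedSymmRect_iff.2 (Or.inr hz)),
    rectBoundaryIntegral_eq_zero_of_differentiableOn hA hY hgd, add_zero,
    rectBoundaryIntegral_sum hA hY _ _ hcont]
  push_cast
  rw [Finset.mul_sum]
  refine Finset.sum_congr rfl fun w hw => ?_
  rw [rectBoundaryIntegral_const_mul, rectBoundaryIntegral_inv_sub (hsr w hw)]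
  ring

/-- As `f` is nonzero at a corner, every order is finite, so passing from `ℕ∞` to `ℕ` by `toNat`
loses nothing. -/
lemma hasExactlyZeros_symmRect_iff (hA : 0 < A) (hY : 0 < Y) (hf : Differentiable ℂ f)
    (hb : ∀ z ∈ rectBoundary A Y, f z ≠ 0) (N : ℕ) :
    HasExactlyZeros f (symmRect A Y) N ↔
      rectBoundaryIntegral A Y (logDeriv f) = 2 * Real.pi * Complex.I * N := by
  have hfin := finite_zerosIn_symmRect hA hY hf hb
  have hne := hf.analyticOrderAt_ne_top (hb _ (corner_mem_rectBoundary hA hY))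
  have hsum : ∑ᶠ z ∈ zerosIn f (symmRect A Y), analyticOrderAt f z =
      ((∑ w ∈ hfin.toFinset, (analyticOrderAt f w).toNat : ℕ) : ℕ∞) := by
    rw [finsum_mem_eq_finite_toFinset_sum _ hfin]
    push_cast
    exact Finset.sum_congr rfl fun w _ => (ENat.natCast_toNat (hne w)).symm
  rw [rectBoundaryIntegral_logDeriv hA hY hf hb, mul_right_inj' Complex.two_pi_I_ne_zero,
    Nat.cast_inj, HasExactlyZeros, hsum, Nat.cast_inj]
  exact and_iff_right hfin

/-- **Rouché's theorem** on a rectangle. -/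
theorem HasExactlyZeros.of_norm_sub_lt (hA : 0 < A) (hY : 0 < Y) (hf : Differentiable ℂ f)
    (hg : Differentiable ℂ g) (h : ∀ z ∈ rectBoundary A Y, ‖g z - f z‖ < ‖f z‖) {N : ℕ}
    (hN : HasExactlyZeros f (symmRect A Y) N) : HasExactlyZeros g (symmRect A Y) N := by
  have hf0 : ∀ z ∈ rectBoundary A Y, f z ≠ 0 := fun z hz h0 => by
    have := h z hz
    rw [h0, norm_zero] at this
    exact (norm_nonneg _).not_gt this
  have hg0 : ∀ z ∈ rectBoundary A Y, g z ≠ 0 := fun z hz h0 => by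
    have := h z hz
    rw [h0, zero_sub, norm_neg] at this
    exact lt_irrefl _ this
  have hcont : ∀ k : ℂ → ℂ, Differentiable ℂ k → (∀ z ∈ rectBoundary A Y, k z ≠ 0) →
      ContinuousOn (logDeriv k) (rectBoundary A Y) := fun k hk hk0 z hz =>
    ((hk.analyticAt z).deriv.continuousAt.div (hk z).continuousAt (hk0 z hz)).continuousWithinAt
  -- On the boundary `g / f` stays in the unit disc around 1, so `log (g / f)` is a single-valued
  -- primitive of `g'/g - f'/f`, and the two zero counts agree.
  have hq : ∀ z ∈ rectBoundary A Y, g z / f z ∈ Complex.slitPlane := fun z hz => by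
    have hlt : ‖g z / f z - 1‖ < 1 := by
      rw [div_sub_one (hf0 z hz), norm_div, div_lt_one (norm_pos_iff.2 (hf0 z hz))]
      exact h z hz
    refine Complex.ball_one_subset_slitPlane ?_
    rwa [Metric.mem_ball, dist_eq_norm]
  have hdiff : rectBoundaryIntegral A Y (fun z => logDeriv g z + (-1) * logDeriv f z) = 0 := by
    refine rectBoundaryIntegral_eq_zero_of_hasDerivAt (G := fun z => Complex.log (g z / f z)) hA hY
      ((hcont g hg hg0).add (continuousOn_const.mul (hcont f hf hf0))) fun z hz => ?_
    have := ((hg z).hasDerivAt.fun_div (hf z).hasDerivAt (hf0 z hz)).clog (hq z hz)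
    convert this using 1
    have := hf0 z hz
    have := hg0 z hz
    simp only [logDeriv_apply]
    field_simp
    ring
  rw [rectBoundaryIntegral_add (G := fun z => (-1) * logDeriv f z) hA hY (hcont g hg hg0)
      (continuousOn_const.mul (hcont f hf hf0)),
    rectBoundaryIntegral_const_mul] at hdiff
  rw [hasExactlyZeros_symmRect_iff hA hY hg hg0]
  rw [hasExactlyZeros_symmRect_iff hA hY hf hf0] at hN
  linear_combination hdiff + hN

end zeros

/-! ### Estimates on the boundary of the rectangle. -/

lemma Complex.norm_sin_sq (z : ℂ) :
    ‖Complex.sin z‖ ^ 2 = Real.sin z.re ^ 2 + Real.sinh z.im ^ 2 := by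
  rw [Complex.sin_eq, ← Complex.normSq_eq_norm_sq]
  simp only [← Complex.ofReal_sin, ← Complex.ofReal_cos, ← Complex.ofReal_sinh,
    ← Complex.ofReal_cosh, ← Complex.ofReal_mul, Complex.normSq_add_mul_I]
  have h1 := Real.sin_sq_add_cos_sq z.re
  have h2 := Real.cosh_sq z.im
  linear_combination Real.sin z.re ^ 2 * h2 + Real.sinh z.im ^ 2 * h1

lemma Complex.norm_cos_sq (z : ℂ) :
    ‖Complex.cos z‖ ^ 2 = Real.cos z.re ^ 2 + Real.sinh z.im ^ 2 := by
  rw [Complex.cos_eq, sub_eq_add_neg, ← neg_mul, ← Complex.normSq_eq_norm_sq]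
  simp only [← Complex.ofReal_sin, ← Complex.ofReal_cos, ← Complex.ofReal_sinh,
    ← Complex.ofReal_cosh, ← Complex.ofReal_mul, ← Complex.ofReal_neg, Complex.normSq_add_mul_I]
  have h1 := Real.sin_sq_add_cos_sq z.re
  have h2 := Real.cosh_sq z.im
  linear_combination Real.cos z.re ^ 2 * h2 + Real.sinh z.im ^ 2 * h1

/-- On the boundary of the rectangle, `cos (L z)` is controlled by `sin (L z)`. -/
lemma norm_cos_le_two_mul_norm_sin {L Y : ℝ} (hL : 0 < L) (hY : 1 ≤ L * Y) (n : ℕ) {z : ℂ}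
    (hz : z ∈ rectBoundary ((n + 1 / 2) * Real.pi / L) Y) :
    ‖Complex.cos (L * z)‖ ≤ 2 * ‖Complex.sin (L * z)‖ ∧ 0 < ‖Complex.sin (L * z)‖ := by
  have hs := Complex.norm_sin_sq (L * z)
  have hc := Complex.norm_cos_sq (L * z)
  simp only [Complex.re_ofReal_mul, Complex.im_ofReal_mul] at hs hc
  -- On horizontal sides `L * Y ≥ 1` gives `sinh² ≥ 1 ≥ cos²`. On vertical sides the half-integer
  -- abscissa makes the real cosine vanish and `sin² = 1`.
  have key : Real.cos (L * z.re) ^ 2 + Real.sinh (L * z.im) ^ 2 ≤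
      4 * (Real.sin (L * z.re) ^ 2 + Real.sinh (L * z.im) ^ 2) ∧
      0 < Real.sin (L * z.re) ^ 2 + Real.sinh (L * z.im) ^ 2 := by
    have hsc := Real.sin_sq_add_cos_sq (L * z.re)
    rcases hz with ⟨-, hz⟩ | ⟨hz, -⟩
    · have h1 : 1 ≤ Real.sinh (L * z.im) ^ 2 := by
        have h2 : 1 ≤ Real.sinh (L * Y) := hY.trans (Real.self_le_sinh_iff.2 (by linarith))
        have h3 : |Real.sinh (L * z.im)| = Real.sinh (L * Y) := by
          rw [Real.abs_sinh, abs_mul, hz, abs_of_pos hL]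
        rw [← sq_abs, h3]
        exact one_le_pow₀ h2
      have := sq_nonneg (Real.sin (L * z.re))
      constructor <;> nlinarith
    · have h0 : Real.cos (L * z.re) = 0 := by
        rw [← Real.cos_abs, abs_mul, hz, abs_of_pos hL, Real.cos_eq_zero_iff]
        exact ⟨n, by field_simp; push_cast; ring⟩
      have := sq_nonneg (Real.sinh (L * z.im))
      rw [h0] at hsc ⊢
      constructor <;> nlinarith
  rw [← hs, ← hc] at key
  have hpos : 0 < ‖Complex.sin (L * z)‖ := by
    refine (norm_nonneg _).lt_of_ne fun h => ?_
    rw [← h] at key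
    simp at key
  refine ⟨abs_le_of_sq_le_sq' ?_ (by positivity) |>.2, hpos⟩
  linarith [key.1, mul_pow 2 ‖Complex.sin (L * z)‖ 2]

lemma le_norm_of_mem_rectBoundary {A Y r : ℝ} (hA : r ≤ A) (hY : r ≤ Y) {z : ℂ}
    (hz : z ∈ rectBoundary A Y) : r ≤ ‖z‖ := by
  rcases hz with ⟨-, hz⟩ | ⟨hz, -⟩
  · exact hY.trans (hz ▸ Complex.abs_im_le_norm z)
  · exact hA.trans (hz ▸ Complex.abs_re_le_norm z)

lemma norm_eigenvalueFun_sub_lt {α L Y : ℝ} (hα : 0 < α) (hL : 0 < L) {n : ℕ}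
    (hn : 5 * α ≤ (n + 1 / 2) * Real.pi / L) (hY : 5 * α ≤ Y) (hLY : 1 ≤ L * Y) {z : ℂ}
    (hz : z ∈ rectBoundary ((n + 1 / 2) * Real.pi / L) Y) :
    ‖eigenvalueFun α L z - z ^ 2 * Complex.sin (L * z)‖ < ‖z ^ 2 * Complex.sin (L * z)‖ := by
  obtain ⟨hc, hs⟩ := norm_cos_le_two_mul_norm_sin hL hLY n hz
  have hr := le_norm_of_mem_rectBoundary hn hY hz
  have e : eigenvalueFun α L z - z ^ 2 * Complex.sin (L * z) =
      (α : ℂ) ^ 2 * Complex.sin (L * z) + 2 * Complex.I * α * z * Complex.cos (L * z) := by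
    unfold eigenvalueFun; ring
  rw [e]
  calc _ ≤ α ^ 2 * ‖Complex.sin (L * z)‖ + 2 * α * ‖z‖ * ‖Complex.cos (L * z)‖ := by
        refine (norm_add_le _ _).trans_eq ?_
        simp [abs_of_pos hα]
    _ ≤ α ^ 2 * ‖Complex.sin (L * z)‖ + 2 * α * ‖z‖ * (2 * ‖Complex.sin (L * z)‖) := by gcongr
    _ = (α ^ 2 + 4 * α * ‖z‖) * ‖Complex.sin (L * z)‖ := by ring
    _ < ‖z‖ ^ 2 * ‖Complex.sin (L * z)‖ := by
        gcongr
        -- Since `|z| ≥ 5α`, `α² + 4α|z| ≤ (1/25 + 4/5) |z|² < |z|²`; this is where the 5 comes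
        -- from.
        nlinarith
    _ = _ := by rw [norm_mul, norm_pow]

/-! ### Zeros of the comparison function. -/

lemma zerosIn_sq_mul_sin {L Y : ℝ} (hL : 0 < L) (hY : 0 < Y) (n : ℕ) :
    zerosIn (fun z : ℂ => z ^ 2 * Complex.sin (L * z)) (symmRect ((n + 1 / 2) * Real.pi / L) Y) =
      (fun k : ℤ => ((k * Real.pi / L : ℝ) : ℂ)) '' (Finset.Icc (-n : ℤ) n : Set ℤ) := by
  have hL' : (L : ℂ) ≠ 0 := by exact_mod_cast hL.ne'
  have hlt : ∀ k : ℤ, |k * Real.pi / L| < (n + 1 / 2) * Real.pi / L ↔ -(n : ℤ) ≤ k ∧ k ≤ n := by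
    intro k
    rw [abs_div, abs_mul, abs_of_pos hL, abs_of_pos Real.pi_pos, div_lt_div_iff_of_pos_right hL,
      mul_lt_mul_iff_left₀ Real.pi_pos, ← abs_le, ← Int.cast_abs]
    constructor
    · intro h
      -- Weakening `n + 1/2` to `n + 1` costs nothing for an integer `|k|`.
      have : ((|k| : ℤ) : ℝ) < ((n + 1 : ℤ) : ℝ) := by push_cast at h ⊢; linarith
      exact Int.lt_add_one_iff.1 (by exact_mod_cast this)
    · intro h
      have : ((|k| : ℤ) : ℝ) ≤ ((n : ℤ) : ℝ) := by exact_mod_cast h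
      push_cast at this ⊢
      linarith
  ext z
  simp only [zerosIn, symmRect, mem_ofPred_eq, mem_image, Finset.coe_Icc, mem_Icc, mul_eq_zero,
    pow_eq_zero_iff two_ne_zero, Complex.sin_eq_zero_iff]
  constructor
  · rintro ⟨⟨hre, -⟩, rfl | ⟨k, hk⟩⟩
    · exact ⟨0, by simp⟩
    · have hz : z = ((k * Real.pi / L : ℝ) : ℂ) := by
        push_cast
        rw [← hk]
        field_simp
      rw [hz, Complex.ofReal_re] at hre
      exact ⟨k, (hlt k).1 hre, hz.symm⟩
  · rintro ⟨k, hk, rfl⟩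
    refine ⟨⟨by rw [Complex.ofReal_re]; exact (hlt k).2 hk, by simpa using hY⟩, Or.inr ⟨k, ?_⟩⟩
    push_cast
    field_simp

lemma analyticOrderAt_sq_mul_sin {L : ℝ} (hL : 0 < L) (k : ℤ) :
    analyticOrderAt (fun z : ℂ => z ^ 2 * Complex.sin (L * z)) ((k * Real.pi / L : ℝ) : ℂ) =
      ((1 + if k = 0 then 2 else 0 : ℕ) : ℕ∞) := by
  have hL' : (L : ℂ) ≠ 0 := by exact_mod_cast hL.ne'
  set w : ℂ := ((k * Real.pi / L : ℝ) : ℂ) with hw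
  have hLw : L * w = k * Real.pi := by
    rw [hw]
    push_cast
    field_simp
  have hsin : AnalyticAt ℂ (fun z : ℂ => Complex.sin (L * z)) w :=
    Differentiable.analyticAt (by fun_prop) w
  have hpow : AnalyticAt ℂ (fun z : ℂ => z ^ 2) w := Differentiable.analyticAt (by fun_prop) w
  have hd : HasDerivAt (fun z : ℂ => Complex.sin (L * z)) (Complex.cos (L * w) * L) w := by
    simpa using ((hasDerivAt_id w).const_mul (L : ℂ)).csin
  have h1 : analyticOrderAt (fun z : ℂ => Complex.sin (L * z)) w = 1 := by
    refine hsin.analyticOrderAt_eq_one_of_zero_deriv_ne_zero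
      (by rw [hLw]; exact Complex.sin_int_mul_pi k) ?_
    rw [hd.deriv, hLw]
    -- Sine and cosine have no common zero, so the zero of the sine is simple.
    refine mul_ne_zero (fun h => ?_) hL'
    have := Complex.sin_sq_add_cos_sq (k * Real.pi)
    rw [h, Complex.sin_int_mul_pi] at this
    simp at this
  have h2 : analyticOrderAt (fun z : ℂ => z ^ 2) w = ((if k = 0 then 2 else 0 : ℕ) : ℕ∞) := by
    split_ifs with hk
    · have : w = 0 := by simp [hw, hk]
      have h := analyticOrderAt_centeredMonomial (𝕜 := ℂ) (z₀ := 0) (n := 2)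
      rw [this, ← h]
      congr 1
      ext z
      simp
    · rw [Nat.cast_zero, hpow.analyticOrderAt_eq_zero]
      refine pow_ne_zero _ ?_
      rw [hw, Complex.ofReal_ne_zero]
      exact div_ne_zero (mul_ne_zero (by exact_mod_cast hk) Real.pi_ne_zero) hL.ne'
  have := analyticOrderAt_mul hpow hsin
  rw [h1, h2] at this
  rw [Nat.cast_add, Nat.cast_one, add_comm]
  exact this

lemma hasExactlyZeros_sq_mul_sin {L Y : ℝ} (hL : 0 < L) (hY : 0 < Y) (n : ℕ) :
    HasExactlyZeros (fun z : ℂ => z ^ 2 * Complex.sin (L * z))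
      (symmRect ((n + 1 / 2) * Real.pi / L) Y) (2 * n + 3) := by
  rw [HasExactlyZeros, zerosIn_sq_mul_sin hL hY]
  refine ⟨(Finset.finite_toSet _).image _, ?_⟩
  have hinj : Function.Injective (fun k : ℤ => ((k * Real.pi / L : ℝ) : ℂ)) := fun a b h => by
    have h' := Complex.ofReal_injective h
    have := Real.pi_ne_zero
    have := hL.ne'
    field_simp at h'
    exact_mod_cast h'
  rw [finsum_mem_image hinj.injOn, finsum_mem_coe_finset]
  simp only [analyticOrderAt_sq_mul_sin hL]
  -- Each of the `2n + 1` indices contributes 1, and `k = 0` contributes 2 more from `z ^ 2`.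
  rw [← Nat.cast_sum, Nat.cast_inj, Finset.sum_add_distrib, Finset.sum_ite_eq']
  simp
  omega

/-! ### Choice of the thresholds and conclusion. -/

theorem mainTheorem2 (α L : ℝ) (hα : 0 < α) (hL : 0 < L) :
    ∃ Y₀ : ℝ, α < Y₀ ∧ ∃ n₀ : ℕ, 0 < n₀ ∧
      ∀ n : ℕ, n₀ < n → ∀ Y : ℝ, Y₀ < Y →
        HasExactlyZeros (eigenvalueFun α L) (openRect L n Y) (2 * n + 3) := by
  have hL1 : 0 < 1 / L := by positivity
  -- In `Y₀`, `5α` secures `|z| ≥ 5α` on horizontal sides and `1 / L` secures `L * Y ≥ 1`. The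
  -- ceiling gives `n ≥ 5αL`, enough for the vertical sides because `π > 1`; the added 1 makes `n₀`
  -- positive.
  refine ⟨5 * α + 1 / L, by linarith, ⌈5 * α * L⌉₊ + 1, by omega, fun n hn Y hY => ?_⟩
  have hY0 : 0 < Y := by linarith
  have hLY : 1 ≤ L * Y := by
    have : L * (1 / L) ≤ L * Y := by gcongr; linarith
    rwa [mul_one_div_cancel hL.ne'] at this
  have hnα : 5 * α ≤ (n + 1 / 2) * Real.pi / L := by
    have h1 : 5 * α * L ≤ n := (Nat.le_ceil _).trans (by exact_mod_cast (by omega))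
    rw [le_div_iff₀ hL]
    have h2 := Real.pi_gt_three
    have h3 : (0 : ℝ) ≤ n := n.cast_nonneg
    nlinarith
  -- `openRect L n Y` is definitionally the `symmRect` of half-width `(n + 1/2)π/L`.
  refine (hasExactlyZeros_sq_mul_sin hL hY0 n).of_norm_sub_lt (by positivity) hY0
    (by fun_prop) (by unfold eigenvalueFun; fun_prop) fun z hz =>
    norm_eigenvalueFun_sub_lt hα hL hnα (by linarith) hLY hz
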